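/- All graphs are finite and simple. For $P=(x,y)$ put $d(P)=x^2+y^2$. A (real or complex) realisation of a graph $G=(V,E)$ is a map $p:V\to\mathbb{R}^2$ or $p:V\to\mathbb{C}^2$; it is generic if the $2|V|$ coordinates of the points $p(v)$, $v\in V$, are algebraically independent over $\mathbb{Q}$. Two realisations $p,q$ of $G$ are equivalent if $d(p(u)-p(v))=d(q(u)-q(v))$ for all $uv\in E$, and congruent if this holds for all $u,v\in V$. A real realisation $p$ of $G$ is rigid if there is $\epsilon>0$ such that every real realisation $q$ of $G$ which is equivalent to $p$ and satisfies $d(p(v)-q(v))<\epsilon$ for all $v\in V$ is congruent to $p$; the graph $G$ is rigid if some generic real realisation of $G$ is rigid. For a rigid graph $G$, let $c(G)$ be the number of congruence classes of complex realisations of $G$ which are equivalent to a given generic complex realisation $p$ of $G$; this number is finite and does not depend on the choice of $p$. (a) Let $G$ be a rigid graph, let $v_n$ be a vertex of $G$ whose set of neighbours is $\{v_1,v_2,v_3\}$ with $v_1,v_2,v_3$ distinct, and suppose that $G-v_n$ is rigid. Then $c(G)=c\big((G-v_n)\cup\{v_1v_2,v_2v_3,v_1v_3\}\big)$ and $c(G)\le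 c\big((G-v_n)+v_1v_2\big)$, where edges that are already present are not added again. (b) Consequently, a type 2 Henneberg move on a redundant edge does not increase $c$: if $H$ is a rigid graph, $xy$ is an edge of $H$ such that $H-xy$ is rigid, $z$ is a vertex of $H$ distinct from $x$ and $y$, and $G$ is obtained from $H-xy$ by adding a new vertex joined exactly to $x$, $y$ and $z$, then $c(G)\le c(H)$. -/

import Mathlib

namespace Realisation

/-- The quadratic form `d(x, y) = x² + y²` on `K²`. -/
def d {K : Type*} [CommRing K] (P : Fin 2 → K) : K := P 0 ^ 2 + P 1 ^ 2

/-- A realisation `p : V → K²` is generic if its coordinates (as a family indexed by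
`V × {0, 1}`) are algebraically independent over `ℚ`. -/
def IsGeneric {V K : Type*} [CommRing K] [Algebra ℚ K] (p : V → Fin 2 → K) : Prop :=
  AlgebraicIndependent ℚ (fun i : V × Fin 2 => p i.1 i.2)

/-- `(G, p)` and `(G, q)` are equivalent: corresponding edges have the same value of `d`. -/
def AreEquivalent {V K : Type*} [CommRing K] (G : SimpleGraph V) (p q : V → Fin 2 → K) : Prop :=
  ∀ u v, G.Adj u v → d (p u - p v) = d (q u - q v)

/-- `p` and `q` are congruent: `d` agrees on all pairs of vertices. -/
def AreCongruent {V K : Type*} [CommRing K] (p q : V → Fin 2 → K) : Prop :=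
  ∀ u v, d (p u - p v) = d (q u - q v)

/-- The real framework `(G, p)` is rigid: every equivalent realisation that is close enough to
`p` is congruent to `p`. -/
def IsRigidFramework {V : Type*} (G : SimpleGraph V) (p : V → Fin 2 → ℝ) : Prop :=
  ∃ ε > 0, ∀ q : V → Fin 2 → ℝ,
    AreEquivalent G p q → (∀ v, d (p v - q v) < ε) → AreCongruent p q

/-- A graph is rigid if some generic real realisation of it is rigid. -/
def IsRigid {V : Type*} (G : SimpleGraph V) : Prop :=
  ∃ p : V → Fin 2 → ℝ, IsGeneric p ∧ IsRigidFramework G p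

/-- Congruence, as an equivalence relation on the complex realisations equivalent to `(G, p)`. -/
def congruenceSetoid {V : Type*} (G : SimpleGraph V) (p : V → Fin 2 → ℂ) :
    Setoid {q : V → Fin 2 → ℂ // AreEquivalent G p q} where
  r q q' := AreCongruent q.1 q'.1
  iseqv :=
    { refl := fun _ _ _ => rfl
      symm := fun h u v => (h u v).symm
      trans := fun h h' u v => (h u v).trans (h' u v) }

/-- `c(G, p)`: the number (possibly `⊤`) of congruence classes of complex realisations of `G`
which are equivalent to `(G, p)`. -/
noncomputable def classCount {V : Type*} (G : SimpleGraph V) (p : V → Fin 2 → ℂ) : ℕ∞ :=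
  ENat.card (Quotient (congruenceSetoid G p))

/-- `c(G) = k`: generic complex realisations of `G` exist, and the natural number `k` is the
common value of `c(G, p)` over all of them. -/
def HasCount {V : Type*} (G : SimpleGraph V) (k : ℕ) : Prop :=
  (∃ p : V → Fin 2 → ℂ, IsGeneric p) ∧
    ∀ p : V → Fin 2 → ℂ, IsGeneric p → classCount G p = k

/-- The graph `G - v`, with vertex set `V \ {v}`. -/
def deleteVertex {V : Type*} (G : SimpleGraph V) (v : V) :
    SimpleGraph (({v}ᶜ : Set V)) :=
  G.induce ({v}ᶜ : Set V)

/-- The edge `xy` of the rigid graph `H` is redundant: `H - xy` is rigid. -/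
def IsRedundantEdge {W : Type*} (H : SimpleGraph W) (x y : W) : Prop :=
  IsRigid H ∧ H.Adj x y ∧ IsRigid (H.deleteEdges {s(x, y)})

/-- The type 2 Henneberg move on `H`: delete the edge `xy`, add a new vertex (`none`) and join it
to `x`, `y` and `z`. -/
def hennebergTwo {W : Type*} (H : SimpleGraph W) (x y z : W) : SimpleGraph (Option W) :=
  (H.deleteEdges {s(x, y)}).map Function.Embedding.some ⊔
    SimpleGraph.edge none (some x) ⊔ SimpleGraph.edge none (some y) ⊔
    SimpleGraph.edge none (some z)

end Realisation

/-! A vertex `v` of degree three freezes the triangle of its neighbours. Let `p` be generic and `q`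
equivalent to `p`. Since `G - v` is rigid, all squared distances of `q` on `G - v` are algebraic
over the field generated by `p` on `G - v`, whereas `p v` is algebraically independent over the
algebraic closure `K` of that field. The planar vectors `q v - q₁`, `q₂ - q₁`, `q₃ - q₁` have zero
Gram determinant; the three edge lengths at `v` turn this into a polynomial relation for `p v` over
`K`, hence an identity. Its coefficients force `q₁ q₂ q₃` to have the side lengths of `p₁ p₂ p₃`
(`triangle_eq_of_generic`).

So restriction sends realisations equivalent to `p` to realisations of `G - v` plus the triangle.
The triangle is nondegenerate, so `v` can be put back, uniquely up to congruence: the classes are in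
bijection (`IsThreeExtension.classCount_eq`). Removing two triangle edges can only add classes,
which gives the inequality; a Henneberg move is the case `G - v = H - xy`.

Real rigidity enters only through `IsRigid.isAlgebraicallyRigid`: a squared distance transcendental
over the edge lengths could be varied independently of them near a generic point. Algebraic rigidity
also makes the counts finite; field automorphisms of `ℂ` make them independent of the generic point.
-/

namespace Realisation

/-! ### Squared distances as polynomials; algebraic dependence on the edge lengths. -/

open MvPolynomial

variable {V W K : Type*}

/-- The generic squared distance between the points with labels `u` and `w`. -/
noncomputable def distPoly (u w : V) : MvPolynomial (V × Fin 2) ℚ :=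
  (X (u, 0) - X (w, 0)) ^ 2 + (X (u, 1) - X (w, 1)) ^ 2

/-- Evaluation of polynomials in the coordinates at a realisation. -/
noncomputable def evalAt [CommRing K] [Algebra ℚ K] (p : V → Fin 2 → K) :
    MvPolynomial (V × Fin 2) ℚ →ₐ[ℚ] K :=
  aeval fun i => p i.1 i.2

theorem evalAt_distPoly [CommRing K] [Algebra ℚ K] (p : V → Fin 2 → K) (u w : V) :
    evalAt p (distPoly u w) = d (p u - p w) := by
  simp [evalAt, distPoly, d]

theorem evalAt_injective [CommRing K] [Algebra ℚ K] {p : V → Fin 2 → K} (hp : IsGeneric p) :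
    Function.Injective (evalAt p) :=
  hp

theorem distPoly_ne_zero {u w : V} (h : u ≠ w) : distPoly u w ≠ 0 := by
  classical
  intro h0
  have := congrArg (evalAt (fun v i => if v = u ∧ i = 0 then (1 : ℚ) else 0)) h0
  rw [evalAt_distPoly] at this
  simp [d, h.symm] at this

/-- The squared edge lengths of `G`. -/
def edgePolys (G : SimpleGraph V) : Set (MvPolynomial (V × Fin 2) ℚ) :=
  {f | ∃ u w, G.Adj u w ∧ distPoly u w = f}

theorem edgePolys_finite [Finite V] (G : SimpleGraph V) : (edgePolys G).Finite := by
  refine (Set.finite_range fun e : V × V => distPoly e.1 e.2).subset ?_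
  rintro f ⟨u, w, -, rfl⟩
  exact ⟨(u, w), rfl⟩

/-- The subalgebra generated by the squared edge lengths of `G`. -/
noncomputable abbrev edgeAlgebra (G : SimpleGraph V) : Subalgebra ℚ (MvPolynomial (V × Fin 2) ℚ) :=
  Algebra.adjoin ℚ (edgePolys G)

/-- All squared distances depend algebraically on the squared edge lengths. -/
def IsAlgebraicallyRigid (G : SimpleGraph V) : Prop :=
  ∀ u w : V, IsAlgebraic (edgeAlgebra G) (distPoly u w)

theorem evalAt_eq_of_mem_edgeAlgebra [CommRing K] [Algebra ℚ K] {G : SimpleGraph V}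
    {p q : V → Fin 2 → K} (h : AreEquivalent G p q) {f : MvPolynomial (V × Fin 2) ℚ}
    (hf : f ∈ edgeAlgebra G) : evalAt p f = evalAt q f := by
  refine Algebra.adjoin_induction (p := fun f _ => evalAt p f = evalAt q f) ?_ ?_ ?_ ?_ hf
  · rintro _ ⟨u, w, huw, rfl⟩
    simpa only [evalAt_distPoly] using h u w huw
  · intro r; simp
  · intro a b _ _ ha hb; simp [ha, hb]
  · intro a b _ _ ha hb; simp [ha, hb]

theorem IsAlgebraicallyRigid.isAlgebraic_of_mem {G : SimpleGraph V} (hG : IsAlgebraicallyRigid G)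
    {f : MvPolynomial (V × Fin 2) ℚ}
    (hf : f ∈ Algebra.adjoin ℚ (Set.range fun e : V × V => distPoly e.1 e.2)) :
    IsAlgebraic (edgeAlgebra G) f := by
  refine Algebra.adjoin_induction (p := fun f _ => IsAlgebraic (edgeAlgebra G) f) ?_ ?_ ?_ ?_ hf
  · rintro _ ⟨e, rfl⟩
    exact hG e.1 e.2
  · intro r
    exact isAlgebraic_algebraMap (R := edgeAlgebra G) (algebraMap ℚ (edgeAlgebra G) r)
  · intro a b _ _ ha hb; exact ha.add hb
  · intro a b _ _ ha hb; exact ha.mul hb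

theorem edgeAlgebra_mono {G H : SimpleGraph V} (h : G ≤ H) : edgeAlgebra G ≤ edgeAlgebra H :=
  Algebra.adjoin_mono fun _ ⟨u, w, huw, hf⟩ => ⟨u, w, h huw, hf⟩

theorem IsAlgebraicallyRigid.mono {G H : SimpleGraph V} (h : G ≤ H)
    (hG : IsAlgebraicallyRigid G) : IsAlgebraicallyRigid H := by
  intro u w
  obtain ⟨F, hF, hFu⟩ := hG u w
  let φ := Subalgebra.inclusion (edgeAlgebra_mono h)
  refine ⟨F.map φ.toRingHom, ?_, ?_⟩
  · rwa [Ne, Polynomial.map_eq_zero_iff (Subalgebra.inclusion_injective _)]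
  · rw [← hFu, Polynomial.aeval_def, Polynomial.eval₂_map, Polynomial.aeval_def]
    rfl

theorem AreEquivalent.mono {G H : SimpleGraph V} [CommRing K] {p q : V → Fin 2 → K}
    (h : G ≤ H) (hq : AreEquivalent H p q) : AreEquivalent G p q :=
  fun u w huw => hq u w (h huw)

/-- The values at `p` of the polynomials in `edgeAlgebra G`. -/
noncomputable def edgeEval [CommRing K] [Algebra ℚ K] (G : SimpleGraph V) (p : V → Fin 2 → K) :
    edgeAlgebra G →+* K :=
  (evalAt p).toRingHom.comp (edgeAlgebra G).val.toRingHom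

theorem edgeEval_injective [CommRing K] [Algebra ℚ K] {G : SimpleGraph V} {p : V → Fin 2 → K}
    (hp : IsGeneric p) : Function.Injective (edgeEval G p) :=
  (evalAt_injective hp).comp Subtype.val_injective

/-- Polynomials in the edge lengths take the same values at `p` and `q`, so coefficients may be
evaluated at `p` and the variable at `q`. -/
theorem eval₂_edgeEval_eq [CommRing K] [Algebra ℚ K] {G : SimpleGraph V} {p q : V → Fin 2 → K}
    (h : AreEquivalent G p q) (F : Polynomial (edgeAlgebra G)) (f : MvPolynomial (V × Fin 2) ℚ) :
    (F.map (edgeEval G p)).eval (evalAt q f) = evalAt q (Polynomial.aeval f F) := by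
  have : edgeEval G p = edgeEval G q :=
    RingHom.ext fun x => evalAt_eq_of_mem_edgeAlgebra h x.2
  rw [this, Polynomial.eval_map, Polynomial.aeval_def]
  exact (Polynomial.hom_eval₂ F (algebraMap (edgeAlgebra G) _) (evalAt q).toRingHom f).symm

/-- A polynomial function that depends algebraically on the edge lengths is, on the realisations
equivalent to a generic one, a root of a fixed polynomial over the field of the generic point. -/
theorem exists_polynomial_of_isAlgebraic [Field K] [Algebra ℚ K] {G : SimpleGraph V}
    {p : V → Fin 2 → K} (hp : IsGeneric p) {f : MvPolynomial (V × Fin 2) ℚ}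
    (hf : IsAlgebraic (edgeAlgebra G) f) :
    ∃ F : Polynomial (edgeAlgebra G), F.map (edgeEval G p) ≠ 0 ∧
      ∀ q, AreEquivalent G p q → (F.map (edgeEval G p)).eval (evalAt q f) = 0 := by
  obtain ⟨F, hF, hFf⟩ := hf
  refine ⟨F, ?_, fun q hq => ?_⟩
  · rwa [Ne, Polynomial.map_eq_zero_iff (edgeEval_injective hp)]
  · rw [eval₂_edgeEval_eq hq, hFf, map_zero]

/-- Take an algebraic relation for `f` with nonzero constant coefficient. If `f` vanished at `q`,
that coefficient would vanish at the generic `p`. -/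
theorem evalAt_ne_zero_of_isAlgebraic [Field K] [Algebra ℚ K] {G : SimpleGraph V}
    {p q : V → Fin 2 → K} (hp : IsGeneric p) (hq : AreEquivalent G p q)
    {f : MvPolynomial (V × Fin 2) ℚ} (hf : IsAlgebraic (edgeAlgebra G) f) (hf0 : f ≠ 0) :
    evalAt q f ≠ 0 := by
  intro h0
  obtain ⟨F, hF, hFf⟩ :=
    hf.exists_nonzero_coeff_and_aeval_eq_zero (mem_nonZeroDivisors_of_ne_zero hf0)
  have h := eval₂_edgeEval_eq hq F f
  rw [hFf, map_zero, h0, ← Polynomial.coeff_zero_eq_eval_zero, Polynomial.coeff_map] at h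
  exact hF ((map_eq_zero_iff _ (edgeEval_injective hp)).1 h)

theorem isAlgebraic_evalAt [Field K] [Algebra ℚ K] {G : SimpleGraph V}
    {p q : V → Fin 2 → K} (hp : IsGeneric p) (hq : AreEquivalent G p q)
    {f : MvPolynomial (V × Fin 2) ℚ} (hf : IsAlgebraic (edgeAlgebra G) f)
    (L : IntermediateField ℚ K) (hL : ∀ u i, p u i ∈ L) : IsAlgebraic L (evalAt q f) := by
  obtain ⟨F, hF, hFf⟩ := exists_polynomial_of_isAlgebraic hp hf
  have hmem : ∀ g, evalAt p g ∈ L := by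
    have hle : (evalAt p).range ≤ L.toSubalgebra := by
      rw [evalAt, ← Algebra.adjoin_range_eq_range_aeval, Algebra.adjoin_le_iff]
      rintro _ ⟨i, rfl⟩
      exact hL i.1 i.2
    exact fun g => hle ⟨g, rfl⟩
  let φ : edgeAlgebra G →+* L := (edgeEval G p).codRestrict L fun x => hmem x.1
  have hφ : (F.map φ).map (algebraMap L K) = F.map (edgeEval G p) := by
    rw [Polynomial.map_map]; rfl
  refine ⟨F.map φ, fun h => hF ?_, ?_⟩
  · rw [← hφ, h, Polynomial.map_zero]
  · rw [← hFf q hq, ← hφ, Polynomial.eval_map_algebraMap]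

theorem finite_evalAt_of_isAlgebraic [Field K] [Algebra ℚ K] {G : SimpleGraph V}
    {p : V → Fin 2 → K} (hp : IsGeneric p) {f : MvPolynomial (V × Fin 2) ℚ}
    (hf : IsAlgebraic (edgeAlgebra G) f) :
    {t | ∃ q, AreEquivalent G p q ∧ evalAt q f = t}.Finite := by
  classical
  obtain ⟨F, hF, hFf⟩ := exists_polynomial_of_isAlgebraic hp hf
  refine ((F.map (edgeEval G p)).roots.toFinset.finite_toSet).subset ?_
  rintro _ ⟨q, hq, rfl⟩
  simpa [hF] using hFf q hq

end Realisation

/-! ### The Jacobian criterion, and algebraic rigidity from real rigidity. -/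

namespace Realisation

open MvPolynomial Filter Topology

section Jacobian

variable {σ : Type*} [Fintype σ]

/-- The derivative at `x` of the function defined by the polynomial `f`, in direction `v`. -/
noncomputable def polyFDeriv (f : MvPolynomial σ ℚ) (x : σ → ℝ) : (σ → ℝ) →L[ℝ] ℝ :=
  ∑ k, aeval x (pderiv k f) • ContinuousLinearMap.proj (R := ℝ) (φ := fun _ : σ => ℝ) k

theorem polyFDeriv_apply (f : MvPolynomial σ ℚ) (x v : σ → ℝ) :
    polyFDeriv f x v = ∑ k, aeval x (pderiv k f) * v k := by
  simp [polyFDeriv]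

theorem polyFDeriv_C (r : ℚ) (x : σ → ℝ) : polyFDeriv (C r) x = 0 := by
  ext v; simp [polyFDeriv_apply]

theorem polyFDeriv_X (k : σ) (x v : σ → ℝ) : polyFDeriv (X k) x v = v k := by
  classical
  rw [polyFDeriv_apply, Finset.sum_eq_single k]
  · simp
  · intro j _ hj; simp [pderiv_X, hj.symm]
  · simp

theorem polyFDeriv_add (f g : MvPolynomial σ ℚ) (x : σ → ℝ) :
    polyFDeriv (f + g) x = polyFDeriv f x + polyFDeriv g x := by
  ext v; simp [polyFDeriv_apply, add_mul, Finset.sum_add_distrib]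

theorem polyFDeriv_mul (f g : MvPolynomial σ ℚ) (x : σ → ℝ) :
    polyFDeriv (f * g) x = aeval x f • polyFDeriv g x + aeval x g • polyFDeriv f x := by
  ext v
  simp only [polyFDeriv_apply, pderiv_mul, add_apply,
    smul_apply, smul_eq_mul, Finset.mul_sum, ← Finset.sum_add_distrib,
    map_add, map_mul]
  exact Finset.sum_congr rfl fun k _ => by ring

theorem hasStrictFDerivAt_aeval (f : MvPolynomial σ ℚ) (x : σ → ℝ) :
    HasStrictFDerivAt (fun y : σ → ℝ => aeval y f) (polyFDeriv f x) x := by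
  induction f using MvPolynomial.induction_on with
  | C r => simpa [polyFDeriv_C] using hasStrictFDerivAt_const (𝕜 := ℝ) (r : ℝ) x
  | add f g hf hg => 
    rw [polyFDeriv_add]
    exact (hf.add hg).congr_of_eventuallyEq (.of_forall fun y => by simp)
  | mul_X f k hf =>
    have hX : HasStrictFDerivAt (fun y : σ → ℝ => aeval y (X k : MvPolynomial σ ℚ))
        (polyFDeriv (X k) x) x := by
      have : polyFDeriv (X k) x = ContinuousLinearMap.proj (R := ℝ) (φ := fun _ : σ => ℝ) k := by
        ext1 v; simp [polyFDeriv_X]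
      simpa [this] using hasStrictFDerivAt_apply (𝕜 := ℝ) k x
    rw [polyFDeriv_mul]
    exact (hf.mul hX).congr_of_eventuallyEq (.of_forall fun y => by simp)

theorem polyFDeriv_eq_zero_of_mem_adjoin {t : Set (MvPolynomial σ ℚ)} {x v : σ → ℝ}
    (h : ∀ f ∈ t, polyFDeriv f x v = 0) {f : MvPolynomial σ ℚ} (hf : f ∈ Algebra.adjoin ℚ t) :
    polyFDeriv f x v = 0 := by
  refine Algebra.adjoin_induction (p := fun f _ => polyFDeriv f x v = 0) h ?_ ?_ ?_ hf
  · intro r; rw [MvPolynomial.algebraMap_eq, polyFDeriv_C]; rfl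
  · intro a b _ _ ha hb; simp [polyFDeriv_add, ha, hb]
  · intro a b _ _ ha hb; simp [polyFDeriv_mul, ha, hb]

/-- The direction `v` annihilates the differentials of the coefficients, so only the chain rule term
survives. -/
theorem polyFDeriv_aeval {S : Subalgebra ℚ (MvPolynomial σ ℚ)} {x v : σ → ℝ}
    (h : ∀ f ∈ S, polyFDeriv f x v = 0) (F : Polynomial S) (g : MvPolynomial σ ℚ) :
    polyFDeriv (Polynomial.aeval g F) x v =
      aeval x (Polynomial.aeval g F.derivative) * polyFDeriv g x v := by
  induction F using Polynomial.induction_on with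
  | C a =>
    simpa using h a.1 a.2
  | add p q hp hq => simp [polyFDeriv_add, hp, hq, add_mul]
  | monomial n a ih =>
    have ha : polyFDeriv (algebraMap S (MvPolynomial σ ℚ) a) x v = 0 := h a.1 a.2
    rw [pow_succ, ← mul_assoc, map_mul, polyFDeriv_mul, Polynomial.derivative_mul]
    simp only [Polynomial.aeval_X, add_apply, smul_apply,
      smul_eq_mul, Polynomial.derivative_X, mul_one, map_add (Polynomial.aeval g),
      map_mul (Polynomial.aeval g) _ Polynomial.X, map_add (aeval x), map_mul (aeval x) _ g]
    rw [ih]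
    ring

/-- Jacobian criterion: the differentials of a transcendence basis are independent at a generic
point. -/
theorem eq_zero_of_polyFDeriv_eq_zero {t : Set (MvPolynomial σ ℚ)}
    (ht : IsTranscendenceBasis ℚ ((↑) : t → MvPolynomial σ ℚ)) {x v : σ → ℝ}
    (hx : AlgebraicIndependent ℚ x) (h : ∀ f ∈ t, polyFDeriv f x v = 0) : v = 0 := by
  funext k
  have halg := ht.isAlgebraic
  rw [Subtype.range_coe] at halg
  -- Minimal degree ensures that the derivative of `F`, nonzero in characteristic zero, does not
  -- vanish at `X k`.
  obtain ⟨F, hF0, hF, hmin⟩ : ∃ F : Polynomial (Algebra.adjoin ℚ t), F ≠ 0 ∧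
      Polynomial.aeval (X k : MvPolynomial σ ℚ) F = 0 ∧
      ∀ F' : Polynomial (Algebra.adjoin ℚ t), F' ≠ 0 →
        Polynomial.aeval (X k : MvPolynomial σ ℚ) F' = 0 → F.natDegree ≤ F'.natDegree := by
    classical
    have hex : ∃ n, ∃ F : Polynomial (Algebra.adjoin ℚ t), F ≠ 0 ∧
      Polynomial.aeval (X k : MvPolynomial σ ℚ) F = 0 ∧ F.natDegree = n := by
      obtain ⟨F, h1, h2⟩ := halg.isAlgebraic (X k)
      exact ⟨_, F, h1, h2, rfl⟩
    obtain ⟨F, h1, h2, h3⟩ := Nat.find_spec hex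
    exact ⟨F, h1, h2, fun F' h1' h2' => h3 ▸ Nat.find_min' hex ⟨F', h1', h2', rfl⟩⟩
  have hdeg : F.natDegree ≠ 0 := by
    intro h0
    rw [Polynomial.natDegree_eq_zero] at h0
    obtain ⟨a, rfl⟩ := h0
    rw [Polynomial.aeval_C] at hF
    have ha : a = 0 := Subtype.val_injective hF
    exact hF0 (by rw [ha, map_zero])
  have hder0 : F.derivative ≠ 0 := fun h0 => hdeg (Polynomial.derivative_eq_zero.1 h0)
  have hder : Polynomial.aeval (X k : MvPolynomial σ ℚ) F.derivative ≠ 0 := fun h0 =>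
    absurd (hmin _ hder0 h0) (not_le.2 (Polynomial.natDegree_derivative_lt hdeg))
  have key := polyFDeriv_aeval (S := Algebra.adjoin ℚ t) (x := x) (v := v)
    (fun f hf => polyFDeriv_eq_zero_of_mem_adjoin h hf) F (X k)
  rw [hF, polyFDeriv_X, ← C_0, polyFDeriv_C] at key
  have hne : aeval x (Polynomial.aeval (X k : MvPolynomial σ ℚ) F.derivative) ≠ 0 := fun h0 =>
    hder (hx (by rw [h0, map_zero]))
  exact (mul_eq_zero.1 key.symm).resolve_left hne

/-- A transcendence basis has as many elements as there are variables, so the Jacobian is square and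
injectivity gives surjectivity. -/
theorem surjective_polyFDeriv_of_isTranscendenceBasis {t : Set (MvPolynomial σ ℚ)}
    (ht : IsTranscendenceBasis ℚ ((↑) : t → MvPolynomial σ ℚ)) {x : σ → ℝ}
    (hx : AlgebraicIndependent ℚ x) :
    Function.Surjective fun (v : σ → ℝ) (f : t) => polyFDeriv f.1 x v := by
  have hcard := ht.lift_cardinalMk_eq (IsTranscendenceBasis.mvPolynomial σ ℚ)
  simp only [Cardinal.mk_fintype, Cardinal.lift_natCast] at hcard
  have hfin : Finite t := by
    rw [← Cardinal.lt_aleph0_iff_finite, ← Cardinal.lift_lt_aleph0, hcard]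
    exact Cardinal.natCast_lt_aleph0
  have := Fintype.ofFinite t
  simp only [Cardinal.mk_fintype, Cardinal.lift_natCast, Nat.cast_inj] at hcard
  let J : (σ → ℝ) →ₗ[ℝ] (t → ℝ) := LinearMap.pi fun f => (polyFDeriv f.1 x).toLinearMap
  have hinj : Function.Injective J := by
    rw [← LinearMap.ker_eq_bot, LinearMap.ker_eq_bot']
    intro v hv
    exact eq_zero_of_polyFDeriv_eq_zero ht hx fun f hf => congrFun hv ⟨f, hf⟩
  exact (LinearMap.injective_iff_surjective_of_finrank_eq_finrank (by simp [hcard])).1 hinj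

/-- Completing `s` to a transcendence basis shows that the map is a submersion at a generic point,
hence locally open there. -/
theorem map_nhds_aeval_eq {s : Set (MvPolynomial σ ℚ)} (hs : s.Finite)
    (hind : AlgebraicIndepOn ℚ id s) {x : σ → ℝ} (hx : AlgebraicIndependent ℚ x) :
    map (fun (y : σ → ℝ) (f : s) => aeval y f.1) (𝓝 x) = 𝓝 fun f : s => aeval x f.1 := by
  have := hs.fintype
  obtain ⟨t, hst, ht⟩ := exists_isTranscendenceBasis_superset hind
  have hd : HasStrictFDerivAt (fun (y : σ → ℝ) (f : s) => aeval y f.1)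
      (ContinuousLinearMap.pi fun f : s => polyFDeriv f.1 x) x :=
    hasStrictFDerivAt_pi.2 fun f => hasStrictFDerivAt_aeval f.1 x
  refine hd.map_nhds_eq_of_surj ?_
  rw [LinearMap.range_eq_top]
  intro w
  classical
  obtain ⟨v, hv⟩ := surjective_polyFDeriv_of_isTranscendenceBasis ht hx
    fun f => if h : f.1 ∈ s then w ⟨f.1, h⟩ else 0
  refine ⟨v, funext fun f => ?_⟩
  simpa using congrFun hv ⟨f.1, hst f.2⟩

end Jacobian

/-- A polynomial function algebraic over `S` is locally constant on the set of points where the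
elements of `S` keep the value they have at a generic point. -/
theorem eventually_aeval_eq_of_isAlgebraic {σ : Type*} [Finite σ]
    {s : Set (MvPolynomial σ ℚ)} {x : σ → ℝ} (hx : AlgebraicIndependent ℚ x)
    {f : MvPolynomial σ ℚ} (hf : IsAlgebraic (Algebra.adjoin ℚ s) f) :
    ∀ᶠ y in 𝓝 x, (∀ g ∈ s, aeval y g = aeval x g) → aeval y f = aeval x f := by
  classical
  have := Fintype.ofFinite σ
  obtain ⟨F, hF, hFf⟩ := hf
  let ev : (σ → ℝ) → Algebra.adjoin ℚ s →+* ℝ := fun y =>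
    (aeval y : MvPolynomial σ ℚ →ₐ[ℚ] ℝ).toRingHom.comp (Algebra.adjoin ℚ s).val.toRingHom
  have hev : Function.Injective (ev x) :=
    (algebraicIndependent_iff_injective_aeval.1 hx).comp Subtype.val_injective
  have hF' : F.map (ev x) ≠ 0 := by rwa [Ne, Polynomial.map_eq_zero_iff hev]
  -- The other roots of the specialised relation form a finite set, which values of `f` near `aeval
  -- x f` avoid.
  have hopen : {r : ℝ | r ∈ (F.map (ev x)).roots.toFinset.erase (aeval x f)}ᶜ ∈ 𝓝 (aeval x f) :=
    (Finset.finite_toSet _).isClosed.isOpen_compl.mem_nhds (by simp)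
  have hcont : ContinuousAt (fun y : σ → ℝ => aeval y f) x :=
    (hasStrictFDerivAt_aeval f x).continuousAt
  filter_upwards [hcont hopen] with y hy hys
  by_contra hne
  refine hy ?_
  have hxy : ev x = ev y := by
    refine RingHom.ext fun a => ?_
    refine Algebra.adjoin_induction (p := fun g _ => (aeval x g : ℝ) = aeval y g) ?_ ?_ ?_ ?_ a.2
    · exact fun g hg => (hys g hg).symm
    · intro r; simp
    · intro a b _ _ ha hb; simp [ha, hb]
    · intro a b _ _ ha hb; simp [ha, hb]
  have hroot : (F.map (ev x)).eval (aeval y f) = 0 := by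
    rw [hxy, Polynomial.eval_map]
    have := Polynomial.hom_eval₂ F (algebraMap (Algebra.adjoin ℚ s) _)
      (aeval y : MvPolynomial σ ℚ →ₐ[ℚ] ℝ).toRingHom f
    rw [← Polynomial.aeval_def, hFf, map_zero] at this
    exact this.symm
  simp [hne, hF', hroot]

/-- If a squared distance `g` were transcendental over the edge lengths, it could be changed near
`p` with all edge lengths fixed, contradicting rigidity. -/
theorem IsRigid.isAlgebraicallyRigid {V : Type*} [Finite V] {G : SimpleGraph V} (hG : IsRigid G) :
    IsAlgebraicallyRigid G := by
  classical
  have := Fintype.ofFinite V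
  obtain ⟨p, hp, ε, hε, hrig⟩ := hG
  intro u w
  by_contra htr
  -- `B` is a maximal algebraically independent set of edge lengths. The remaining ones are locally
  -- constant where `B` is fixed, so it suffices to control `insert g B`.
  obtain ⟨B, hB⟩ := (AlgebraicIndependent.matroid ℚ (MvPolynomial (V × Fin 2) ℚ)).exists_isBasis
    (edgePolys G)
  rw [edgeAlgebra, ← AlgebraicIndependent.isAlgebraic_adjoin_iff_of_matroid_isBasis hB] at htr
  obtain ⟨hBind, hBE, hBalg⟩ := AlgebraicIndependent.matroid_isBasis_iff.1 hB
  set g := distPoly u w with hg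
  have hind : AlgebraicIndepOn ℚ id (insert g B) := by
    refine AlgebraicIndepOn.insert hBind ?_
    rwa [Set.image_id]
  have hBfin : B.Finite := (edgePolys_finite G).subset hBE
  have hgB : g ∉ B := fun h =>
    htr (isAlgebraic_algebraMap (⟨g, Algebra.subset_adjoin h⟩ : Algebra.adjoin ℚ B))
  let x : V × Fin 2 → ℝ := fun i => p i.1 i.2
  have hmap := map_nhds_aeval_eq (hBfin.insert g) hind (x := x) hp
  have h1 : ∀ᶠ y in 𝓝 x, ∀ f ∈ edgePolys G,
      (∀ b ∈ B, aeval y b = aeval x b) → aeval y f = aeval x f :=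
    (Set.Finite.eventually_all (edgePolys_finite G)).2 fun f hf =>
      eventually_aeval_eq_of_isAlgebraic hp (hBalg f hf)
  have h2 : ∀ᶠ y in 𝓝 x, ∀ v, d (p v - fun i => y (v, i)) < ε := by
    refine eventually_all.2 fun v => ?_
    have hc : Continuous fun y : V × Fin 2 → ℝ => d (p v - fun i => y (v, i)) := by
      unfold d; simp only [Pi.sub_apply]; fun_prop
    refine (hc.tendsto x).eventually_lt_const ?_
    simpa [d, x] using hε
  have himg := image_mem_map (m := fun (y : V × Fin 2 → ℝ) (f : ↥(insert g B)) => aeval y f.1)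
    (h1.and h2)
  rw [hmap] at himg
  let c : ↥(insert g B) → ℝ := fun f => aeval x f.1
  let shift : ℝ → (↥(insert g B) → ℝ) := fun r => 
    Function.update c ⟨g, Set.mem_insert _ _⟩ (c ⟨g, Set.mem_insert _ _⟩ + r)
  have hshift : Tendsto shift (𝓝[≠] 0) (𝓝 c) := by
    have : Continuous shift := by
      refine continuous_const.update _ (by fun_prop)
    have h := this.tendsto 0
    have h0 : shift 0 = c := by simp [shift]
    rw [h0] at h
    exact h.mono_left nhdsWithin_le_nhds
  -- By openness some small `r ≠ 0` is realised: `y` keeps the values on `B` and moves `g` by `r`.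
  obtain ⟨r, ⟨y, ⟨hy1, hy2⟩, hy⟩, hr⟩ := ((hshift.eventually himg).and self_mem_nhdsWithin).exists
  have hyB : ∀ b ∈ B, aeval y b = aeval x b := by
    intro b hb
    have := congrFun hy ⟨b, Set.mem_insert_of_mem _ hb⟩
    have hne : (⟨b, Set.mem_insert_of_mem _ hb⟩ : ↥(insert g B)) ≠ ⟨g, Set.mem_insert _ _⟩ :=
      by
      intro h
      have hbg : b = g := Subtype.ext_iff.1 h
      exact hgB (hbg ▸ hb)
    simpa only [shift, Function.update_of_ne hne] using this
  let q : V → Fin 2 → ℝ := fun v i => y (v, i)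
  have hevq : ∀ f, aeval y f = evalAt q f := fun f => rfl
  have hevp : ∀ f, aeval x f = evalAt p f := fun f => rfl
  have hcong := hrig q (fun a b hab => by
    have := hy1 _ ⟨a, b, hab, rfl⟩ hyB
    rw [hevq, hevp, evalAt_distPoly, evalAt_distPoly] at this
    exact this.symm) hy2 u w
  have hgy := congrFun hy ⟨g, Set.mem_insert _ _⟩
  simp only [shift, Function.update_self, c] at hgy
  rw [hevq, hevp, hg, evalAt_distPoly, evalAt_distPoly, hcong] at hgy
  exact hr (by simpa using hgy)

end Realisation

/-! ### Finiteness of the count and its independence of the generic point. -/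

namespace Realisation

open MvPolynomial

theorem quotient_mk_eq_iff {V : Type*} {G : SimpleGraph V} {p : V → Fin 2 → ℂ}
    {q q' : {q : V → Fin 2 → ℂ // AreEquivalent G p q}} :
    (Quotient.mk (congruenceSetoid G p) q = Quotient.mk (congruenceSetoid G p) q') ↔
      AreCongruent q.1 q'.1 :=
  Quotient.eq

theorem classCount_le_of_map {V V' : Type*} {A : SimpleGraph V} {B : SimpleGraph V'}
    {p : V → Fin 2 → ℂ} {p' : V' → Fin 2 → ℂ}
    (φ : {q // AreEquivalent A p q} → {q // AreEquivalent B p' q})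
    (hφ : ∀ q q', AreCongruent (φ q).1 (φ q').1 ↔ AreCongruent q.1 q'.1) :
    classCount A p ≤ classCount B p' := by
  have hinj : Function.Injective (Quotient.map (sa := congruenceSetoid A p)
      (sb := congruenceSetoid B p') φ fun q q' => (hφ q q').2) := by
    refine fun x y => Quotient.inductionOn₂ x y fun q q' h => ?_
    have h' : Quotient.mk (congruenceSetoid B p') (φ q) =
        Quotient.mk (congruenceSetoid B p') (φ q') := h
    rw [quotient_mk_eq_iff, hφ] at h'
    exact quotient_mk_eq_iff.2 h'
  unfold classCount
  exact ENat.card_le_card_of_injective hinj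

theorem classCount_anti {V : Type*} {A B : SimpleGraph V} (h : A ≤ B) (p : V → Fin 2 → ℂ) :
    classCount B p ≤ classCount A p :=
  classCount_le_of_map (fun q => ⟨q.1, q.2.mono h⟩) fun _ _ => Iff.rfl

/-- A class is determined by its squared distances, each of which has finitely many possible values.
-/
theorem finite_quotient_of_isAlgebraicallyRigid {V : Type*} [Finite V] {G : SimpleGraph V}
    (hG : IsAlgebraicallyRigid G) {p : V → Fin 2 → ℂ} (hp : IsGeneric p) :
    Finite (Quotient (congruenceSetoid G p)) := by
  have hfin : ∀ e : V × V, Finite {t : ℂ | ∃ q, AreEquivalent G p q ∧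
      evalAt q (distPoly e.1 e.2) = t} :=
    fun e => finite_evalAt_of_isAlgebraic hp (hG e.1 e.2)
  let φ : Quotient (congruenceSetoid G p) → ∀ e : V × V, {t : ℂ | ∃ q, AreEquivalent G p q ∧
      evalAt q (distPoly e.1 e.2) = t} :=
    Quotient.lift (fun q e => ⟨evalAt q.1 (distPoly e.1 e.2), q.1, q.2, rfl⟩) fun q q' h => by
      funext e
      refine Subtype.ext ?_
      simpa only [evalAt_distPoly] using h e.1 e.2
  refine Finite.of_injective φ ?_
  rintro ⟨q⟩ ⟨q'⟩ h
  refine Quotient.sound fun u w => ?_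
  have huw : evalAt q.1 (distPoly u w) = evalAt q'.1 (distPoly u w) :=
    Subtype.ext_iff.1 (congrFun h (u, w))
  simpa only [evalAt_distPoly] using huw

theorem infinite_of_isTranscendenceBasis {s : Set ℂ}
    (hs : IsTranscendenceBasis ℚ ((↑) : s → ℂ)) : Infinite s := by
  by_contra hfin
  rw [not_infinite_iff_finite] at hfin
  have h := IsAlgClosed.cardinal_le_max_transcendence_basis _ hs
  have h1 : Cardinal.mk s < Cardinal.aleph0 := Cardinal.lt_aleph0_iff_finite.2 hfin
  simp only [Cardinal.lift_id, Cardinal.mkRat] at h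
  rw [max_eq_left h1.le, max_self, Cardinal.mk_complex] at h
  exact absurd Cardinal.aleph0_lt_continuum (not_lt.2 h)

/-- Extend both families to transcendence bases of `ℂ`, match the bases compatibly with `x i ↦ y i`,
and extend the resulting isomorphism to the algebraic closures. -/
theorem exists_ringEquiv_apply_eq {ι : Type*} [Finite ι] {x y : ι → ℂ}
    (hx : AlgebraicIndependent ℚ x) (hy : AlgebraicIndependent ℚ y) :
    ∃ σ : ℂ ≃+* ℂ, ∀ i, σ (x i) = y i := by
  obtain ⟨s, hxs, hs⟩ := exists_isTranscendenceBasis_superset hx.to_subtype_range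
  obtain ⟨t, hyt, ht⟩ := exists_isTranscendenceBasis_superset hy.to_subtype_range
  have hcard := Cardinal.eq.1 (hs.cardinalMk_eq ht)
  have hsinf := infinite_of_isTranscendenceBasis hs
  let f : {a : s | a.1 ∈ Set.range x} ↪ t :=
    ⟨fun a => ⟨y a.2.choose, hyt ⟨_, rfl⟩⟩, fun a b h => by
      have h1 : a.2.choose = b.2.choose := hy.injective (Subtype.ext_iff.1 h)
      exact Subtype.ext (Subtype.ext (by rw [← a.2.choose_spec, h1, b.2.choose_spec]))⟩
  -- The prescribed part is finite and the basis infinite, so the partial matching extends to a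
  -- bijection.
  have hlt : Cardinal.mk {a : s | a.1 ∈ Set.range x} < Cardinal.mk s := by
    refine lt_of_lt_of_le (Cardinal.lt_aleph0_iff_finite.2 ?_) (Cardinal.aleph0_le_mk s)
    exact ((Set.finite_range x).preimage Subtype.val_injective.injOn).to_subtype
  obtain ⟨e, he⟩ := Cardinal.extend_function_of_lt f hlt hcard
  have hex : ∀ i, (e ⟨x i, hxs ⟨i, rfl⟩⟩ : ℂ) = y i := by
    intro i
    have hmem : (⟨x i, hxs ⟨i, rfl⟩⟩ : s) ∈ {a : s | a.1 ∈ Set.range x} := ⟨i, rfl⟩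
    rw [he ⟨_, hmem⟩]
    exact congrArg y (hx.injective hmem.choose_spec)
  let := IsAlgClosed.isAlgClosure_of_transcendence_basis _ hs
  let := IsAlgClosed.isAlgClosure_of_transcendence_basis _ ht
  let ε : Algebra.adjoin ℚ (Set.range ((↑) : s → ℂ)) ≃+*
      Algebra.adjoin ℚ (Set.range ((↑) : t → ℂ)) :=
    ((hs.1.aevalEquiv.symm.trans (renameEquiv ℚ e)).trans ht.1.aevalEquiv).toRingEquiv
  refine ⟨IsAlgClosure.equivOfEquiv ℂ ℂ ε, fun i => ?_⟩
  have hxi : x i = algebraMap (Algebra.adjoin ℚ (Set.range ((↑) : s → ℂ))) ℂ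
      (hs.1.aevalEquiv (X ⟨x i, hxs ⟨i, rfl⟩⟩)) := by
    rw [hs.1.algebraMap_aevalEquiv, aeval_X]
  rw [hxi, IsAlgClosure.equivOfEquiv_algebraMap]
  have hε : ε (hs.1.aevalEquiv (X ⟨x i, hxs ⟨i, rfl⟩⟩)) =
      ht.1.aevalEquiv (X (e ⟨x i, hxs ⟨i, rfl⟩⟩)) := by
    simp [ε]
  rw [hε, ht.1.algebraMap_aevalEquiv, aeval_X, hex]

theorem exists_isGeneric (V : Type*) [Finite V] : ∃ p : V → Fin 2 → ℂ, IsGeneric p := by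
  obtain ⟨s, hs⟩ := exists_isTranscendenceBasis ℚ ℂ
  have hsinf := infinite_of_isTranscendenceBasis hs
  obtain ⟨n, ⟨e⟩⟩ := Finite.exists_equiv_fin (V × Fin 2)
  let f : V × Fin 2 → s := Infinite.natEmbedding s ∘ Fin.val ∘ e
  have hf : Function.Injective f :=
    (Infinite.natEmbedding s).injective.comp (Fin.val_injective.comp e.injective)
  exact ⟨fun v i => (f (v, i) : ℂ), hs.1.comp f hf⟩

theorem d_map {K L : Type*} [CommRing K] [CommRing L] (σ : K →+* L) (P Q : Fin 2 → K) :
    d ((fun i => σ (P i)) - fun i => σ (Q i)) = σ (d (P - Q)) := by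
  simp [d]

/-- A field automorphism carrying `p` to `p'`, applied coordinatewise, preserves and reflects
equality of squared distances. -/
theorem classCount_le_of_isGeneric {V : Type*} [Finite V] (G : SimpleGraph V)
    {p p' : V → Fin 2 → ℂ} (hp : IsGeneric p) (hp' : IsGeneric p') :
    classCount G p ≤ classCount G p' := by
  obtain ⟨σ, hσ⟩ := exists_ringEquiv_apply_eq hp hp'
  have hσp : p' = fun v i => σ (p v i) := funext fun v => funext fun i => (hσ (v, i)).symm
  subst hσp
  refine classCount_le_of_map (fun q => ⟨fun v i => σ (q.1 v i), fun u w huw => ?_⟩)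
    fun q q' => ?_
  · have := congrArg σ (q.2 u w huw)
    rwa [← RingEquiv.coe_toRingHom, ← d_map, ← d_map] at this
  · refine forall₂_congr fun u w => ?_
    have hd := d_map σ.toRingHom
    exact (Iff.of_eq (congrArg₂ _ (hd _ _) (hd _ _))).trans σ.injective.eq_iff

theorem IsAlgebraicallyRigid.exists_hasCount {V : Type*} [Finite V] {G : SimpleGraph V}
    (hG : IsAlgebraicallyRigid G) : ∃ k, HasCount G k := by
  obtain ⟨p, hp⟩ := exists_isGeneric V
  have := finite_quotient_of_isAlgebraicallyRigid hG hp
  refine ⟨Nat.card (Quotient (congruenceSetoid G p)), ⟨p, hp⟩, fun q hq => ?_⟩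
  rw [le_antisymm (classCount_le_of_isGeneric G hq hp) (classCount_le_of_isGeneric G hp hq),
    classCount, ENat.card_eq_coe_natCard]

end Realisation

/-! ### Plane geometry: Gram determinants and rigidity of the triangle. -/

namespace Realisation

open MvPolynomial

section Plane

variable {K : Type*}

/-- The discriminant of the Gram matrix of the triangle `x₁ x₂ x₃`, up to a factor `4`. -/
def triangleGram [CommRing K] (a b c : K) : K :=
  4 * a * b - (a + b - c) ^ 2

theorem triangleGram_d [CommRing K] (x₁ x₂ x₃ : Fin 2 → K) :
    triangleGram (d (x₁ - x₂)) (d (x₁ - x₃)) (d (x₂ - x₃)) =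
      4 * ((x₂ 0 - x₁ 0) * (x₃ 1 - x₁ 1) - (x₂ 1 - x₁ 1) * (x₃ 0 - x₁ 0)) ^ 2 := by
  simp only [triangleGram, d, Pi.sub_apply]; ring

theorem d_sub_comm [CommRing K] (P Q : Fin 2 → K) : d (P - Q) = d (Q - P) := by
  simp only [d, Pi.sub_apply]; ring

theorem d_sub_self [CommRing K] (P : Fin 2 → K) : d (P - P) = 0 := by
  simp [d]

/-- The distance between two points of the plane is determined by their distances to the vertices
of a non-degenerate triangle. -/
theorem d_sub_mul_triangleGram [CommRing K] (x₁ x₂ x₃ y z : Fin 2 → K) :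
    d (y - z) * triangleGram (d (x₁ - x₂)) (d (x₁ - x₃)) (d (x₂ - x₃)) =
      (d (y - x₁) + d (z - x₁)) * triangleGram (d (x₁ - x₂)) (d (x₁ - x₃)) (d (x₂ - x₃))
      - 2 * ((d (y - x₁) + d (x₁ - x₂) - d (y - x₂)) * (d (z - x₁) + d (x₁ - x₂) - d (z - x₂))
          * d (x₁ - x₃)
        + (d (y - x₁) + d (x₁ - x₃) - d (y - x₃)) * (d (z - x₁) + d (x₁ - x₃) - d (z - x₃))
          * d (x₁ - x₂))
      + ((d (y - x₁) + d (x₁ - x₂) - d (y - x₂)) * (d (z - x₁) + d (x₁ - x₃) - d (z - x₃))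
        + (d (y - x₁) + d (x₁ - x₃) - d (y - x₃)) * (d (z - x₁) + d (x₁ - x₂) - d (z - x₂)))
        * (d (x₁ - x₂) + d (x₁ - x₃) - d (x₂ - x₃)) := by
  simp only [triangleGram, d, Pi.sub_apply]; ring

theorem d_sub_eq_of_triangle [Field K] {x₁ x₂ x₃ y z x₁' x₂' x₃' y' z' : Fin 2 → K}
    (h0 : triangleGram (d (x₁ - x₂)) (d (x₁ - x₃)) (d (x₂ - x₃)) ≠ 0)
    (h12 : d (x₁ - x₂) = d (x₁' - x₂')) (h13 : d (x₁ - x₃) = d (x₁' - x₃'))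
    (h23 : d (x₂ - x₃) = d (x₂' - x₃'))
    (hy1 : d (y - x₁) = d (y' - x₁')) (hy2 : d (y - x₂) = d (y' - x₂'))
    (hy3 : d (y - x₃) = d (y' - x₃'))
    (hz1 : d (z - x₁) = d (z' - x₁')) (hz2 : d (z - x₂) = d (z' - x₂'))
    (hz3 : d (z - x₃) = d (z' - x₃')) : d (y - z) = d (y' - z') := by
  refine mul_right_cancel₀ h0 ?_
  rw [d_sub_mul_triangleGram, h12, h13, h23, hy1, hy2, hy3, hz1, hz2, hz3,
    ← d_sub_mul_triangleGram]

/-- Any point can be transported along a congruence of non-degenerate triangles. -/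
theorem exists_d_sub_eq [Field K] [CharZero K] {x₁ x₂ x₃ x₁' x₂' x₃' : Fin 2 → K} (y : Fin 2 → K)
    (h0 : triangleGram (d (x₁ - x₂)) (d (x₁ - x₃)) (d (x₂ - x₃)) ≠ 0)
    (h12 : d (x₁ - x₂) = d (x₁' - x₂')) (h13 : d (x₁ - x₃) = d (x₁' - x₃'))
    (h23 : d (x₂ - x₃) = d (x₂' - x₃')) :
    ∃ y' : Fin 2 → K, d (y - x₁) = d (y' - x₁') ∧ d (y - x₂) = d (y' - x₂') ∧
      d (y - x₃) = d (y' - x₃') := by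
  rw [triangleGram_d] at h0
  obtain ⟨D, hD⟩ : ∃ D, D = (x₂ 0 - x₁ 0) * (x₃ 1 - x₁ 1) - (x₂ 1 - x₁ 1) * (x₃ 0 - x₁ 0) :=
    ⟨_, rfl⟩
  rw [← hD] at h0
  have hD0 : D ≠ 0 := fun h => h0 (by rw [h]; ring)
  -- `α` and `β` are the affine coordinates of `y` in the triangle, by Cramer's rule; `y'` has the
  -- same coordinates in the other triangle.
  obtain ⟨α, hα⟩ : ∃ α, α * D = (y 0 - x₁ 0) * (x₃ 1 - x₁ 1) - (y 1 - x₁ 1) * (x₃ 0 - x₁ 0) :=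
    ⟨_, div_mul_cancel₀ _ hD0⟩
  obtain ⟨β, hβ⟩ : ∃ β, β * D = (x₂ 0 - x₁ 0) * (y 1 - x₁ 1) - (x₂ 1 - x₁ 1) * (y 0 - x₁ 0) :=
    ⟨_, div_mul_cancel₀ _ hD0⟩
  have hy : ∀ i, y i = x₁ i + α * (x₂ i - x₁ i) + β * (x₃ i - x₁ i) := by
    intro i
    refine mul_right_cancel₀ hD0 ?_
    fin_cases i <;> simp only [Fin.zero_eta, Fin.mk_one] <;>
      rw [add_mul, add_mul, mul_right_comm, hα, mul_right_comm, hβ, hD] <;> ring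
  refine ⟨fun i => x₁' i + α * (x₂' i - x₁' i) + β * (x₃' i - x₁' i), ?_, ?_, ?_⟩ <;>
    simp only [d, Pi.sub_apply, hy] at h12 h13 h23 ⊢
  · linear_combination (α ^ 2 + α * β) * h12 + (β ^ 2 + α * β) * h13 - α * β * h23
  · linear_combination ((α - 1) ^ 2 + (α - 1) * β) * h12 + (β ^ 2 + (α - 1) * β) * h13 -
      (α - 1) * β * h23
  · linear_combination (α ^ 2 + α * (β - 1)) * h12 + ((β - 1) ^ 2 + α * (β - 1)) * h13 -
      α * (β - 1) * h23

/-- If the Gram determinant of `(X, u, w)` vanishes for all `X`, where `X · u` and `X · w` are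
affine functions with linear parts `X · a` and `X · b`, then the Gram matrices of `(u, w)` and
`(a, b)` agree. -/
theorem gram_eq_of_forall [Field K] [CharZero K] {a b : Fin 2 → K} {uu uw ww : K}
    (ha : d a ≠ 0) (hab : a 0 * b 1 - a 1 * b 0 ≠ 0) (hΔ : uu * ww - uw ^ 2 ≠ 0)
    (h : ∀ X Y : K, (X ^ 2 + Y ^ 2) * (uu * ww - uw ^ 2) =
      (X * a 0 + Y * a 1 + (uu - d a) / 2) ^ 2 * ww
      - 2 * (X * a 0 + Y * a 1 + (uu - d a) / 2) * (X * b 0 + Y * b 1 + (ww - d b) / 2) * uw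
      + (X * b 0 + Y * b 1 + (ww - d b) / 2) ^ 2 * uu) :
    uu = d a ∧ ww = d b ∧ uw = a 0 * b 0 + a 1 * b 1 := by
  set c₁ := (uu - d a) / 2 with hc₁
  set c₂ := (ww - d b) / 2 with hc₂
  have hfour : (4 : K) ≠ 0 := by norm_num
  have e1 : c₁ * ww = c₂ * uw := by
    -- Subtracting the identity at two opposite vectors orthogonal to `b` cancels the even terms and
    -- kills `X · b`; `e2` does the same with `a`.
    refine mul_left_cancel₀ hab (mul_left_cancel₀ hfour ?_)
    linear_combination h (- b 1) (b 0) - h (b 1) (- b 0)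
  have e2 : c₂ * uu = c₁ * uw := by
    refine mul_left_cancel₀ hab (mul_left_cancel₀ hfour ?_)
    linear_combination h (a 1) (- a 0) - h (- a 1) (a 0)
  have h1 : c₁ = 0 := by
    refine (mul_eq_zero.1 (?_ : c₁ * (uu * ww - uw ^ 2) = 0)).resolve_right hΔ
    linear_combination uu * e1 + uw * e2
  have h2 : c₂ = 0 := by
    refine (mul_eq_zero.1 (?_ : c₂ * (uu * ww - uw ^ 2) = 0)).resolve_right hΔ
    linear_combination uw * e1 + ww * e2
  have huu : uu = d a := by linear_combination 2 * h1 - 2 * hc₁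
  have hww : ww = d b := by linear_combination 2 * h2 - 2 * hc₂
  refine ⟨huu, hww, ?_⟩
  -- With `c₁ = c₂ = 0`, the identity at the vector `a` itself collapses to `d a` times a square.
  have h3 := h (a 0) (a 1)
  rw [h1, h2, huu, hww] at h3
  have h4 : d a * (uw - (a 0 * b 0 + a 1 * b 1)) ^ 2 = 0 := by
    simp only [d] at h3 ⊢
    linear_combination -h3
  exact sub_eq_zero.1 (pow_eq_zero_iff two_ne_zero |>.1 ((mul_eq_zero.1 h4).resolve_left ha))

end Plane

/-- A polynomial identity that holds at a generic point holds everywhere. -/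
theorem gram_identity_of_generic {K L : Type*} [Field K] [Field L] [CharZero L] [Algebra K L]
    {P : Fin 2 → L} (hP : AlgebraicIndependent K P) {uu uw ww c₁ c₂ : K} {x a b : Fin 2 → K}
    (h : ((P 0 - algebraMap K L (x 0)) ^ 2 + (P 1 - algebraMap K L (x 1)) ^ 2) *
        algebraMap K L (uu * ww - uw ^ 2) =
      ((P 0 - algebraMap K L (x 0)) * algebraMap K L (a 0) +
        (P 1 - algebraMap K L (x 1)) * algebraMap K L (a 1) + algebraMap K L c₁) ^ 2 *
          algebraMap K L ww
      - 2 * ((P 0 - algebraMap K L (x 0)) * algebraMap K L (a 0) +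
        (P 1 - algebraMap K L (x 1)) * algebraMap K L (a 1) + algebraMap K L c₁) *
        ((P 0 - algebraMap K L (x 0)) * algebraMap K L (b 0) +
        (P 1 - algebraMap K L (x 1)) * algebraMap K L (b 1) + algebraMap K L c₂) *
          algebraMap K L uw
      + ((P 0 - algebraMap K L (x 0)) * algebraMap K L (b 0) +
        (P 1 - algebraMap K L (x 1)) * algebraMap K L (b 1) + algebraMap K L c₂) ^ 2 *
          algebraMap K L uu) (X' Y' : K) :
    (X' ^ 2 + Y' ^ 2) * (uu * ww - uw ^ 2) =
      (X' * a 0 + Y' * a 1 + c₁) ^ 2 * ww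
      - 2 * (X' * a 0 + Y' * a 1 + c₁) * (X' * b 0 + Y' * b 1 + c₂) * uw
      + (X' * b 0 + Y' * b 1 + c₂) ^ 2 * uu := by
  let x0 : MvPolynomial (Fin 2) K := X 0 - C (x 0)
  let x1 : MvPolynomial (Fin 2) K := X 1 - C (x 1)
  let s : MvPolynomial (Fin 2) K := x0 * C (a 0) + x1 * C (a 1) + C c₁
  let t : MvPolynomial (Fin 2) K := x0 * C (b 0) + x1 * C (b 1) + C c₂
  have hpoly : (x0 ^ 2 + x1 ^ 2) * C (uu * ww - uw ^ 2) =
      s ^ 2 * C ww - 2 * s * t * C uw + t ^ 2 * C uu := by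
    refine algebraicIndependent_iff_injective_aeval.1 hP ?_
    simpa only [x0, x1, s, t, map_add, map_sub, map_mul, map_pow, aeval_X, aeval_C,
      map_ofNat] using h
  -- The translation by `x` makes `x0` and `x1` evaluate to `X'` and `Y'`.
  have := congrArg (aeval ![X' + x 0, Y' + x 1]) hpoly
  simpa [x0, x1, s, t] using this

/-- `Q` need not be generic, but the differences of the hypotheses make its inner products with `q₂
- q₁` and `q₃ - q₁`, taken from `q₁`, affine in `P` over `K`. The vanishing Gram determinant is then
a relation for `P` over `K`, to which `gram_eq_of_forall` applies. -/
theorem triangle_eq_of_generic {L : Type*} [Field L] [CharZero L] (K : Subfield L)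
    {P Q p₁ p₂ p₃ q₁ q₂ q₃ : Fin 2 → L} (hP : AlgebraicIndependent K P)
    (hp₁ : ∀ i, p₁ i ∈ K) (hp₂ : ∀ i, p₂ i ∈ K) (hp₃ : ∀ i, p₃ i ∈ K)
    (hq12 : d (q₁ - q₂) ∈ K) (hq13 : d (q₁ - q₃) ∈ K) (hq23 : d (q₂ - q₃) ∈ K)
    (hp0 : d (p₁ - p₂) ≠ 0)
    (hp : triangleGram (d (p₁ - p₂)) (d (p₁ - p₃)) (d (p₂ - p₃)) ≠ 0)
    (hq : triangleGram (d (q₁ - q₂)) (d (q₁ - q₃)) (d (q₂ - q₃)) ≠ 0)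
    (h1 : d (P - p₁) = d (Q - q₁)) (h2 : d (P - p₂) = d (Q - q₂))
    (h3 : d (P - p₃) = d (Q - q₃)) :
    d (p₁ - p₂) = d (q₁ - q₂) ∧ d (p₁ - p₃) = d (q₁ - q₃) ∧ d (p₂ - p₃) = d (q₂ - q₃) := by
  have : CharZero K := ⟨fun m n h => Nat.cast_injective (R := L) (congrArg Subtype.val h)⟩
  let x : Fin 2 → K := fun i => ⟨p₁ i, hp₁ i⟩
  let a : Fin 2 → K := fun i => ⟨p₂ i, hp₂ i⟩ - ⟨p₁ i, hp₁ i⟩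
  let b : Fin 2 → K := fun i => ⟨p₃ i, hp₃ i⟩ - ⟨p₁ i, hp₁ i⟩
  let uu : K := ⟨_, hq12⟩
  let ww : K := ⟨_, hq13⟩
  let vv : K := ⟨_, hq23⟩
  -- By polarisation this is the inner product of `q₂ - q₁` and `q₃ - q₁`.
  let uw : K := (uu + ww - vv) / 2
  have hval : ∀ z : K, algebraMap K L z = (z : L) := fun _ => rfl
  have htwo : ((2 : K) : L) = 2 := rfl
  have huu : (uu : L) = d (q₁ - q₂) := rfl
  have hww : (ww : L) = d (q₁ - q₃) := rfl
  have huw : (uw : L) = (d (q₁ - q₂) + d (q₁ - q₃) - d (q₂ - q₃)) / 2 := by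
    simp [uw, uu, ww, vv, htwo]
  have hda : ((d a : K) : L) = d (p₁ - p₂) := by
    simp only [d, a, Pi.sub_apply]; push_cast; ring
  have hdb : ((d b : K) : L) = d (p₁ - p₃) := by
    simp only [d, b, Pi.sub_apply]; push_cast; ring
  have hdab : ((a 0 * b 0 + a 1 * b 1 : K) : L) =
      (d (p₁ - p₂) + d (p₁ - p₃) - d (p₂ - p₃)) / 2 := by
    simp only [d, a, b, Pi.sub_apply]; push_cast; ring
  have ha : d a ≠ 0 := fun h => hp0 (by rw [← hda, h]; rfl)
  have hab : a 0 * b 1 - a 1 * b 0 ≠ 0 := by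
    intro h
    refine hp ?_
    have h' := congrArg (Subtype.val : K → L) h
    simp only [a, b] at h'
    push_cast at h'
    rw [triangleGram_d, h']
    ring
  have hΔ : uu * ww - uw ^ 2 ≠ 0 := by
    intro h
    refine hq ?_
    have h' := congrArg (Subtype.val : K → L) h
    push_cast at h'
    rw [huu, hww, huw] at h'
    rw [triangleGram]
    linear_combination 4 * h'
  obtain ⟨r1, r2, r3⟩ := gram_eq_of_forall ha hab hΔ <|
    gram_identity_of_generic hP (x := x) (a := a) (b := b) (c₁ := (uu - d a) / 2)
      (c₂ := (ww - d b) / 2) <| by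
    have hc1 : (((uu - d a) / 2 : K) : L) = (d (q₁ - q₂) - d (p₁ - p₂)) / 2 := by
      push_cast; rw [huu, hda, htwo]
    have hc2 : (((ww - d b) / 2 : K) : L) = (d (q₁ - q₃) - d (p₁ - p₃)) / 2 := by
      push_cast; rw [hww, hdb, htwo]
    have hs : (P 0 - (x 0 : L)) * (a 0 : L) + (P 1 - (x 1 : L)) * (a 1 : L) +
        (((uu - d a) / 2 : K) : L) =
        (Q 0 - q₁ 0) * (q₂ 0 - q₁ 0) + (Q 1 - q₁ 1) * (q₂ 1 - q₁ 1) := by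
      rw [hc1]
      simp only [x, a]
      push_cast
      simp only [d, Pi.sub_apply] at h1 h2 ⊢
      linear_combination (h1 - h2) / 2
    have ht : (P 0 - (x 0 : L)) * (b 0 : L) + (P 1 - (x 1 : L)) * (b 1 : L) +
        (((ww - d b) / 2 : K) : L) =
        (Q 0 - q₁ 0) * (q₃ 0 - q₁ 0) + (Q 1 - q₁ 1) * (q₃ 1 - q₁ 1) := by
      rw [hc2]
      simp only [x, b]
      push_cast
      simp only [d, Pi.sub_apply] at h1 h3 ⊢
      linear_combination (h1 - h3) / 2
    have hPQ : (P 0 - (x 0 : L)) ^ 2 + (P 1 - (x 1 : L)) ^ 2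
        = (Q 0 - q₁ 0) ^ 2 + (Q 1 - q₁ 1) ^ 2 := h1
    simp only [hval]
    rw [hs, ht, hPQ]
    push_cast
    rw [huu, hww, huw]
    simp only [d, Pi.sub_apply]
    ring
  have r1' := congrArg (Subtype.val : K → L) r1
  have r2' := congrArg (Subtype.val : K → L) r2
  have r3' := congrArg (Subtype.val : K → L) r3
  rw [huu, hda] at r1'
  rw [hww, hdb] at r2'
  rw [huw, hdab] at r3'
  exact ⟨r1'.symm, r2'.symm, by linear_combination 2 * r3' - r1' - r2'⟩

end Realisation

/-! ### Adding or removing a vertex of degree three. -/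

namespace Realisation

open MvPolynomial

variable {V W K : Type*}

theorem IsGeneric.comp [CommRing K] [Algebra ℚ K] {p : V → Fin 2 → K} (hp : IsGeneric p)
    {f : W → V} (hf : Function.Injective f) : IsGeneric fun w => p (f w) :=
  AlgebraicIndependent.comp hp (Prod.map f id) (hf.prodMap Function.injective_id)

/-- The polynomial whose value at a realisation is the Gram discriminant of a triangle. -/
noncomputable def triangleGramPoly (u v w : V) : MvPolynomial (V × Fin 2) ℚ :=
  triangleGram (distPoly u v) (distPoly u w) (distPoly v w)

theorem evalAt_triangleGramPoly [CommRing K] [Algebra ℚ K] (p : V → Fin 2 → K) (u v w : V) :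
    evalAt p (triangleGramPoly u v w) =
      triangleGram (d (p u - p v)) (d (p u - p w)) (d (p v - p w)) := by
  simp only [triangleGramPoly, triangleGram, map_sub, map_mul, map_pow, map_add, map_ofNat,
    evalAt_distPoly]

theorem triangleGramPoly_ne_zero {u v w : V} (huv : u ≠ v) (huw : u ≠ w) (hvw : v ≠ w) :
    triangleGramPoly u v w ≠ 0 := by
  classical
  intro h0
  -- The test realisation puts `v` at `(1, 0)`, `w` at `(0, 1)` and all other vertices at the
  -- origin.
  have := congrArg (evalAt fun x i =>
    if x = v ∧ i = 0 then (1 : ℚ) else if x = w ∧ i = 1 then 1 else 0) h0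
  rw [evalAt_triangleGramPoly, triangleGram_d] at this
  simp [huv, huw, hvw] at this

theorem IsAlgebraicallyRigid.isAlgebraic_triangleGramPoly {G : SimpleGraph V}
    (hG : IsAlgebraicallyRigid G) (u v w : V) :
    IsAlgebraic (edgeAlgebra G) (triangleGramPoly u v w) := by
  refine hG.isAlgebraic_of_mem ?_
  have h : ∀ a b : V, distPoly a b ∈
      Algebra.adjoin ℚ (Set.range fun e : V × V => distPoly e.1 e.2) :=
    fun a b => Algebra.subset_adjoin ⟨(a, b), rfl⟩
  have h4 : (4 : MvPolynomial (V × Fin 2) ℚ) ∈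
      Algebra.adjoin ℚ (Set.range fun e : V × V => distPoly e.1 e.2) := ofNat_mem _ 4
  exact sub_mem (mul_mem (mul_mem h4 (h _ _)) (h _ _))
    (pow_mem (sub_mem (add_mem (h _ _) (h _ _)) (h _ _)) 2)

theorem IsAlgebraicallyRigid.triangleGram_ne_zero [Field K] [Algebra ℚ K] {G : SimpleGraph V}
    (hG : IsAlgebraicallyRigid G) {p q : V → Fin 2 → K} (hp : IsGeneric p)
    (hq : AreEquivalent G p q) {u v w : V} (huv : u ≠ v) (huw : u ≠ w) (hvw : v ≠ w) :
    triangleGram (d (q u - q v)) (d (q u - q w)) (d (q v - q w)) ≠ 0 := by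
  rw [← evalAt_triangleGramPoly]
  exact evalAt_ne_zero_of_isAlgebraic hp hq (hG.isAlgebraic_triangleGramPoly u v w)
    (triangleGramPoly_ne_zero huv huw hvw)

theorem IsAlgebraicallyRigid.d_ne_zero [Field K] [Algebra ℚ K] {G : SimpleGraph V}
    (hG : IsAlgebraicallyRigid G) {p q : V → Fin 2 → K} (hp : IsGeneric p)
    (hq : AreEquivalent G p q) {u v : V} (huv : u ≠ v) : d (q u - q v) ≠ 0 := by
  rw [← evalAt_distPoly]
  exact evalAt_ne_zero_of_isAlgebraic hp hq (hG u v) (distPoly_ne_zero huv)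

/-- `G` arises from the graph `A` by adding the vertex `v`, joined to `v₁`, `v₂` and `v₃`. -/
structure IsThreeExtension (G : SimpleGraph V) (A : SimpleGraph W) (f : W → V) (v : V)
    (v₁ v₂ v₃ : W) : Prop where
  injective : Function.Injective f
  range_eq : Set.range f = {v}ᶜ
  adj_iff : ∀ a b, G.Adj (f a) (f b) ↔ A.Adj a b
  neighborSet_eq : G.neighborSet v = {f v₁, f v₂, f v₃}
  ne₁₂ : v₁ ≠ v₂
  ne₂₃ : v₂ ≠ v₃
  ne₁₃ : v₁ ≠ v₃

namespace IsThreeExtension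

variable {G : SimpleGraph V} {A : SimpleGraph W} {f : W → V} {v : V} {v₁ v₂ v₃ : W}

theorem ne (h : IsThreeExtension G A f v v₁ v₂ v₃) (w : W) : f w ≠ v := by
  have : f w ∈ Set.range f := ⟨w, rfl⟩
  rw [h.range_eq] at this
  exact this

theorem eq_or_exists (h : IsThreeExtension G A f v v₁ v₂ v₃) (u : V) : u = v ∨ ∃ w, f w = u := by
  by_cases hu : u = v
  · exact Or.inl hu
  · right
    have : u ∈ Set.range f := by rw [h.range_eq]; exact hu
    exact this

theorem adj₁ (h : IsThreeExtension G A f v v₁ v₂ v₃) : G.Adj v (f v₁) := by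
  rw [← SimpleGraph.mem_neighborSet, h.neighborSet_eq]; simp

theorem adj₂ (h : IsThreeExtension G A f v v₁ v₂ v₃) : G.Adj v (f v₂) := by
  rw [← SimpleGraph.mem_neighborSet, h.neighborSet_eq]; simp

theorem adj₃ (h : IsThreeExtension G A f v v₁ v₂ v₃) : G.Adj v (f v₃) := by
  rw [← SimpleGraph.mem_neighborSet, h.neighborSet_eq]; simp

theorem restrict_areEquivalent [CommRing K] (h : IsThreeExtension G A f v v₁ v₂ v₃)
    {p q : V → Fin 2 → K} (hq : AreEquivalent G p q) :
    AreEquivalent A (fun w => p (f w)) fun w => q (f w) :=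
  fun a b hab => hq _ _ ((h.adj_iff a b).2 hab)

/-- In a realisation equivalent to a generic one, the neighbours of `v` form a triangle congruent to
the generic one. -/
theorem triangle_eq (h : IsThreeExtension G A f v v₁ v₂ v₃) (hA : IsAlgebraicallyRigid A)
    {p q : V → Fin 2 → ℂ} (hp : IsGeneric p) (hq : AreEquivalent G p q) :
    d (p (f v₁) - p (f v₂)) = d (q (f v₁) - q (f v₂)) ∧
      d (p (f v₁) - p (f v₃)) = d (q (f v₁) - q (f v₃)) ∧
      d (p (f v₂) - p (f v₃)) = d (q (f v₂) - q (f v₃)) := by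
  let x : V × Fin 2 → ℂ := fun i => p i.1 i.2
  let L : IntermediateField ℚ ℂ := IntermediateField.adjoin ℚ (x '' {i | i.1 ≠ v})
  have hpL : ∀ w i, p (f w) i ∈ L := fun w i =>
    IntermediateField.subset_adjoin _ _ ⟨(f w, i), h.ne w, rfl⟩
  have hpA : IsGeneric fun w => p (f w) := hp.comp h.injective
  have hqA := h.restrict_areEquivalent hq
  have hind : AlgebraicIndependent L (p v) := by
    rw [IntermediateField.algebraicIndependent_adjoin_iff]
    have hdisj : Disjoint {i : V × Fin 2 | i.1 ≠ v} {i | i.1 = v} :=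
      Set.disjoint_left.2 fun i hi hi' => hi hi'
    exact (AlgebraicIndependent.adjoin_of_disjoint (x := x) hp hdisj).comp
      (fun i : Fin 2 => ⟨(v, i), rfl⟩) fun i j hij => by simpa using hij
  have hmemp : ∀ w i, p (f w) i ∈ (algebraicClosure L ℂ).toSubfield := fun w i =>
    (algebraicClosure L ℂ).algebraMap_mem ⟨_, hpL w i⟩
  have hmemq : ∀ a b, d (q (f a) - q (f b)) ∈ (algebraicClosure L ℂ).toSubfield := fun a b => by
    have := isAlgebraic_evalAt hpA hqA (hA a b) L hpL
    rw [evalAt_distPoly] at this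
    exact mem_algebraicClosure_iff.2 this
  have hrefl : AreEquivalent A (fun w => p (f w)) fun w => p (f w) := fun _ _ _ => rfl
  -- Passing from `L` to its algebraic closure in `ℂ` brings in the distances of `q` and keeps `p v`
  -- independent.
  exact triangle_eq_of_generic (algebraicClosure L ℂ).toSubfield (P := p v) (Q := q v)
    hind.algebraicClosure
    (hmemp v₁) (hmemp v₂) (hmemp v₃) (hmemq _ _) (hmemq _ _) (hmemq _ _)
    (hA.d_ne_zero hpA hrefl h.ne₁₂) (hA.triangleGram_ne_zero hpA hrefl h.ne₁₂ h.ne₁₃ h.ne₂₃)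
    (hA.triangleGram_ne_zero hpA hqA h.ne₁₂ h.ne₁₃ h.ne₂₃)
    (hq _ _ h.adj₁) (hq _ _ h.adj₂) (hq _ _ h.adj₃)

theorem areEquivalent_triangle_iff [CommRing K] {p q : W → Fin 2 → K} :
    AreEquivalent (A ⊔ SimpleGraph.edge v₁ v₂ ⊔ SimpleGraph.edge v₂ v₃ ⊔ SimpleGraph.edge v₁ v₃)
      p q ↔ AreEquivalent A p q ∧ AreEquivalent (SimpleGraph.edge v₁ v₂) p q ∧
        AreEquivalent (SimpleGraph.edge v₂ v₃) p q ∧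
        AreEquivalent (SimpleGraph.edge v₁ v₃) p q := by
  simp only [AreEquivalent, SimpleGraph.sup_adj]
  constructor
  · intro h
    exact ⟨fun a b hab => h a b (by tauto), fun a b hab => h a b (by tauto),
      fun a b hab => h a b (by tauto), fun a b hab => h a b (by tauto)⟩
  · rintro ⟨h1, h2, h3, h4⟩ a b (((h | h) | h) | h)
    exacts [h1 a b h, h2 a b h, h3 a b h, h4 a b h]

theorem areEquivalent_edge_iff [CommRing K] {p q : W → Fin 2 → K} {a b : W} (hab : a ≠ b) :
    AreEquivalent (SimpleGraph.edge a b) p q ↔ d (p a - p b) = d (q a - q b) := by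
  simp only [AreEquivalent, SimpleGraph.edge_adj]
  constructor
  · intro h
    exact h a b ⟨Or.inl ⟨rfl, rfl⟩, hab⟩
  · rintro h u w ⟨⟨rfl, rfl⟩ | ⟨rfl, rfl⟩, -⟩
    · exact h
    · rw [d_sub_comm, h, d_sub_comm]

theorem restrict_areEquivalent_triangle (h : IsThreeExtension G A f v v₁ v₂ v₃)
    (hA : IsAlgebraicallyRigid A) {p q : V → Fin 2 → ℂ} (hp : IsGeneric p)
    (hq : AreEquivalent G p q) :
    AreEquivalent
      (A ⊔ SimpleGraph.edge v₁ v₂ ⊔ SimpleGraph.edge v₂ v₃ ⊔ SimpleGraph.edge v₁ v₃)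
      (fun w => p (f w)) fun w => q (f w) := by
  obtain ⟨h12, h13, h23⟩ := h.triangle_eq hA hp hq
  rw [areEquivalent_triangle_iff, areEquivalent_edge_iff h.ne₁₂, areEquivalent_edge_iff h.ne₂₃,
    areEquivalent_edge_iff h.ne₁₃]
  exact ⟨h.restrict_areEquivalent hq, h12, h23, h13⟩

/-- The edges at `v` fix its distances to a nondegenerate triangle, and these determine its distance
to every other vertex. -/
theorem areCongruent_iff_restrict (h : IsThreeExtension G A f v v₁ v₂ v₃)
    (hA : IsAlgebraicallyRigid A) {p q q' : V → Fin 2 → ℂ} (hp : IsGeneric p)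
    (hq : AreEquivalent G p q) (hq' : AreEquivalent G p q') :
    AreCongruent (fun w => q (f w)) (fun w => q' (f w)) ↔ AreCongruent q q' := by
  refine ⟨fun hc => ?_, fun hc a b => hc (f a) (f b)⟩
  have h0 := hA.triangleGram_ne_zero (hp.comp h.injective) (h.restrict_areEquivalent hq)
    h.ne₁₂ h.ne₁₃ h.ne₂₃
  have hv : ∀ w, d (q v - q (f w)) = d (q' v - q' (f w)) := fun w =>
    d_sub_eq_of_triangle h0 (hc _ _) (hc _ _) (hc _ _)
      ((hq _ _ h.adj₁).symm.trans (hq' _ _ h.adj₁))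
      ((hq _ _ h.adj₂).symm.trans (hq' _ _ h.adj₂))
      ((hq _ _ h.adj₃).symm.trans (hq' _ _ h.adj₃)) (hc _ _) (hc _ _) (hc _ _)
  intro a b
  rcases h.eq_or_exists a with rfl | ⟨a, rfl⟩ <;> rcases h.eq_or_exists b with rfl | ⟨b, rfl⟩
  · rw [d_sub_self, d_sub_self]
  · exact hv b
  · rw [d_sub_comm, hv, d_sub_comm]
  · exact hc a b

theorem exists_extend (h : IsThreeExtension G A f v v₁ v₂ v₃) (hA : IsAlgebraicallyRigid A)
    {p : V → Fin 2 → ℂ} (hp : IsGeneric p) {q : W → Fin 2 → ℂ}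
    (hq : AreEquivalent
      (A ⊔ SimpleGraph.edge v₁ v₂ ⊔ SimpleGraph.edge v₂ v₃ ⊔ SimpleGraph.edge v₁ v₃)
      (fun w => p (f w)) q) :
    ∃ q' : V → Fin 2 → ℂ, AreEquivalent G p q' ∧ (fun w => q' (f w)) = q := by
  classical
  rw [areEquivalent_triangle_iff, areEquivalent_edge_iff h.ne₁₂, areEquivalent_edge_iff h.ne₂₃,
    areEquivalent_edge_iff h.ne₁₃] at hq
  obtain ⟨hqA, h12, h23, h13⟩ := hq
  obtain ⟨y, hy1, hy2, hy3⟩ := exists_d_sub_eq (p v)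
    (hA.triangleGram_ne_zero (hp.comp h.injective) (fun _ _ _ => rfl) h.ne₁₂ h.ne₁₃ h.ne₂₃)
    h12 h13 h23
  -- The default value `y` is taken only at `v`, the one vertex outside the range of `f`.
  let q' : V → Fin 2 → ℂ := Function.extend f q fun _ => y
  have hq'f : ∀ w, q' (f w) = q w := fun w => h.injective.extend_apply _ _ _
  have hq'v : q' v = y := Function.extend_apply' _ _ _ fun ⟨w, hw⟩ => h.ne w hw
  have hv : ∀ b, G.Adj v b → d (p v - p b) = d (q' v - q' b) := by
    intro b hb
    rw [← SimpleGraph.mem_neighborSet, h.neighborSet_eq] at hb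
    rcases hb with rfl | rfl | rfl <;> rw [hq'v, hq'f] <;> assumption
  refine ⟨q', fun a b hab => ?_, funext hq'f⟩
  rcases h.eq_or_exists a with rfl | ⟨a, rfl⟩
  · exact hv b hab
  · rcases h.eq_or_exists b with rfl | ⟨b, rfl⟩
    · rw [d_sub_comm, hv _ hab.symm, d_sub_comm]
    · rw [hq'f, hq'f]
      exact hqA a b ((h.adj_iff a b).1 hab)

theorem classCount_eq (h : IsThreeExtension G A f v v₁ v₂ v₃) (hA : IsAlgebraicallyRigid A)
    {p : V → Fin 2 → ℂ} (hp : IsGeneric p) :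
    classCount G p = classCount
      (A ⊔ SimpleGraph.edge v₁ v₂ ⊔ SimpleGraph.edge v₂ v₃ ⊔ SimpleGraph.edge v₁ v₃)
      fun w => p (f w) := by
  refine le_antisymm ?_ ?_
  · exact classCount_le_of_map
      (fun q => ⟨fun w => q.1 (f w), h.restrict_areEquivalent_triangle hA hp q.2⟩)
      fun q q' => h.areCongruent_iff_restrict hA hp q.2 q'.2
  · have hex := fun q : {q // AreEquivalent
        (A ⊔ SimpleGraph.edge v₁ v₂ ⊔ SimpleGraph.edge v₂ v₃ ⊔ SimpleGraph.edge v₁ v₃)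
        (fun w => p (f w)) q} => h.exists_extend hA hp q.2
    choose φ hφ hφf using hex
    refine classCount_le_of_map (fun q => ⟨φ q, hφ q⟩) fun q q' => ?_
    -- Extensions are congruent exactly when their restrictions are, so the arbitrary choice of
    -- extension is harmless.
    rw [← h.areCongruent_iff_restrict hA hp (hφ q) (hφ q'), hφf, hφf]

theorem exists_hasCount [Finite V] [Finite W] (h : IsThreeExtension G A f v v₁ v₂ v₃)
    (hA : IsAlgebraicallyRigid A) :
    ∃ k l : ℕ, HasCount G k ∧
      HasCount (A ⊔ SimpleGraph.edge v₁ v₂ ⊔ SimpleGraph.edge v₂ v₃ ⊔ SimpleGraph.edge v₁ v₃) k ∧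
      HasCount (A ⊔ SimpleGraph.edge v₁ v₂) l ∧ k ≤ l := by
  have hle : A ⊔ SimpleGraph.edge v₁ v₂ ≤
      A ⊔ SimpleGraph.edge v₁ v₂ ⊔ SimpleGraph.edge v₂ v₃ ⊔ SimpleGraph.edge v₁ v₃ :=
    le_sup_of_le_left le_sup_left
  have hAl := hA.mono (le_sup_left : A ≤ A ⊔ SimpleGraph.edge v₁ v₂)
  obtain ⟨l, hl⟩ := hAl.exists_hasCount
  obtain ⟨k, hk⟩ := (hAl.mono hle).exists_hasCount
  obtain ⟨p, hp⟩ := hk.1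
  refine ⟨k, l, ⟨exists_isGeneric V, fun q hq => ?_⟩, hk, hl, ?_⟩
  · rw [h.classCount_eq hA hq, hk.2 _ (hq.comp h.injective)]
  · have := classCount_anti hle p
    rwa [hk.2 p hp, hl.2 p hp, Nat.cast_le] at this

end IsThreeExtension

/-! ### The two instances: vertex deletion and the Henneberg move. -/

theorem isThreeExtension_deleteVertex {G : SimpleGraph V} {v : V} {v₁ v₂ v₃ : ({v}ᶜ : Set V)}
    (h12 : v₁ ≠ v₂) (h23 : v₂ ≠ v₃) (h13 : v₁ ≠ v₃)
    (hN : G.neighborSet v = {v₁.1, v₂.1, v₃.1}) :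
    IsThreeExtension G (deleteVertex G v) Subtype.val v v₁ v₂ v₃ where
  injective := Subtype.val_injective
  range_eq := Subtype.range_coe
  adj_iff _ _ := Iff.rfl
  neighborSet_eq := hN
  ne₁₂ := h12
  ne₂₃ := h23
  ne₁₃ := h13

theorem isThreeExtension_hennebergTwo {H : SimpleGraph W} {x y z : W} (hxy : x ≠ y) (hzx : z ≠ x)
    (hzy : z ≠ y) :
    IsThreeExtension (hennebergTwo H x y z) (H.deleteEdges {s(x, y)}) some none x y z where
  injective := Option.some_injective W
  range_eq := by ext a; cases a <;> simp
  adj_iff a b := by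
    simp +contextual [hennebergTwo, SimpleGraph.map_adj', SimpleGraph.edge_adj]
    exact fun h _ _ => h.ne
  neighborSet_eq := by
    ext a
    cases a <;> simp [hennebergTwo, SimpleGraph.map_adj', SimpleGraph.edge_adj, or_assoc, eq_comm]
  ne₁₂ := hxy
  ne₂₃ := hzy.symm
  ne₁₃ := hzx.symm

theorem deleteEdges_sup_edge {H : SimpleGraph W} {x y : W} (h : H.Adj x y) :
    H.deleteEdges {s(x, y)} ⊔ SimpleGraph.edge x y = H := by
  ext a b
  simp only [SimpleGraph.sup_adj, SimpleGraph.deleteEdges_adj, SimpleGraph.edge_adj,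
    Set.mem_singleton_iff, Sym2.eq_iff]
  constructor
  · rintro (h' | ⟨⟨rfl, rfl⟩ | ⟨rfl, rfl⟩, -⟩)
    exacts [h'.1, h, h.symm]
  · intro hab
    have := hab.ne
    tauto

end Realisation

theorem mainTheorem8 :
    (∀ (V : Type*) [Finite V] (G : SimpleGraph V) (v : V) (v₁ v₂ v₃ : ({v}ᶜ : Set V)),
      v₁ ≠ v₂ → v₂ ≠ v₃ → v₁ ≠ v₃ →
      G.neighborSet v = {v₁.1, v₂.1, v₃.1} →
      Realisation.IsRigid G →
      Realisation.IsRigid (Realisation.deleteVertex G v) →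
      ∃ k l : ℕ,
        Realisation.HasCount G k ∧
        Realisation.HasCount (Realisation.deleteVertex G v ⊔ SimpleGraph.edge v₁ v₂ ⊔
          SimpleGraph.edge v₂ v₃ ⊔ SimpleGraph.edge v₁ v₃) k ∧
        Realisation.HasCount (Realisation.deleteVertex G v ⊔ SimpleGraph.edge v₁ v₂) l ∧
        k ≤ l) ∧
    (∀ (W : Type*) [Finite W] (H : SimpleGraph W) (x y z : W),
      z ≠ x → z ≠ y →
      Realisation.IsRedundantEdge H x y →
      ∃ k l : ℕ,
        Realisation.HasCount (Realisation.hennebergTwo H x y z) k ∧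
        Realisation.HasCount H l ∧
        k ≤ l) := by
  refine ⟨fun V _ G v v₁ v₂ v₃ h12 h23 h13 hN _ hrig => ?_, fun W _ H x y z hzx hzy hred => ?_⟩
  · exact (Realisation.isThreeExtension_deleteVertex h12 h23 h13 hN).exists_hasCount
      hrig.isAlgebraicallyRigid
  · obtain ⟨-, hxy, hrig⟩ := hred
    obtain ⟨k, l, hk, -, hl, hkl⟩ := (Realisation.isThreeExtension_hennebergTwo (H := H) hxy.ne
      hzx hzy).exists_hasCount hrig.isAlgebraicallyRigid
    rw [Realisation.deleteEdges_sup_edge hxy] at hl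
    exact ⟨k, l, hk, hl, hkl⟩
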